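/- Let $F$ be a field. For a finite simple undirected graph $G=(V,E)$ and $S\subseteq V$, let $G[S]$ be the subgraph induced by $S$, let $\mathrm{rk}(G[S])$ be the rank over $F$ of the adjacency matrix of $G[S]$, and let $n(G[S])=|S|-\mathrm{rk}(G[S])$. The two-variable interlace polynomial of $G$ (with ranks taken over $F$; the usual choice is $F=\mathbb{F}_2$) is $$q(G;x,y)=\sum_{S\subseteq V}(x-1)^{\mathrm{rk}(G[S])}(y-1)^{n(G[S])}\in\mathbb{Z}[x,y].$$ The deck of $G$ is the multiset of the isomorphism types of the vertex-deleted subgraphs $G_v$, $v\in V$. **Proposition.** The interlace polynomial is reconstructible: if $G$ and $H$ are finite simple graphs, $G$ has at least three vertices, and $G$ and $H$ have the same deck, then $q(G;x,y)=q(H;x,y)$. This holds for every field $F$. -/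

import Mathlib

universe u v

namespace SimpleGraph

/-- Two graphs, each given together with its vertex type, are equivalent when they are
isomorphic. -/
def isoSetoid : Setoid (Σ V : Type u, SimpleGraph V) where
  r A B := Nonempty (A.2 ≃g B.2)
  iseqv :=
    { refl := fun _ => ⟨Iso.refl⟩
      symm := fun ⟨e⟩ => ⟨e.symm⟩
      trans := fun ⟨e⟩ ⟨f⟩ => ⟨e.trans f⟩ }

/-- Isomorphism types of simple graphs. -/
def IsoType : Type (u + 1) := Quotient isoSetoid.{u}

/-- The isomorphism type of a graph. -/
def isoType {V : Type u} (G : SimpleGraph V) : IsoType.{u} :=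
  Quotient.mk isoSetoid ⟨V, G⟩

/-- The vertex-deleted subgraph: `G` with `v` and all edges incident to `v` deleted. -/
def deleteVertex {V : Type u} (G : SimpleGraph V) (v : V) : SimpleGraph ({v}ᶜ : Set V) :=
  G.induce {v}ᶜ

/-- The deck of a finite graph: the multiset of the isomorphism types of its vertex-deleted
subgraphs, one for every vertex. -/
def deck {V : Type u} [Fintype V] (G : SimpleGraph V) : Multiset IsoType.{u} :=
  (Finset.univ : Finset V).val.map fun v => (G.deleteVertex v).isoType

open Classical in
/-- The rank over the field `F` of the adjacency matrix of a finite graph. -/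
noncomputable def rk (F : Type v) [Field F] {V : Type u} [Fintype V] (G : SimpleGraph V) : ℕ :=
  (G.adjMatrix F).rank

/-- The nullity over `F`; the subtraction does not truncate, see `nullity_add_rk`. -/
noncomputable def nullity (F : Type v) [Field F] {V : Type u} [Fintype V]
    (G : SimpleGraph V) : ℕ :=
  Fintype.card V - G.rk F

theorem nullity_add_rk (F : Type v) [Field F] {V : Type u} [Fintype V] (G : SimpleGraph V) :
    G.nullity F + G.rk F = Fintype.card V :=
  Nat.sub_add_cancel (Matrix.rank_le_card_width _)

/-- The two-variable interlace polynomial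
`∑ S ⊆ V, (x - 1) ^ rk G[S] * (y - 1) ^ n G[S]`, with ranks taken over the field `F`
and with `x = X 0`, `y = X 1`. -/
noncomputable def interlacePolynomial (F : Type v) [Field F] {V : Type u} [Fintype V]
    (G : SimpleGraph V) : MvPolynomial (Fin 2) ℤ :=
  ∑ S : Finset V,
    (MvPolynomial.X 0 - 1) ^ (G.induce (S : Set V)).rk F *
      (MvPolynomial.X 1 - 1) ^ (G.induce (S : Set V)).nullity F

end SimpleGraph

/-!
The summands of the interlace polynomial for proper vertex sets are determined by the deck, by
Kelly's lemma (`exists_properSubset_equiv`), so only the rank of the full adjacency matrix `A` is at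
stake. If `A` is singular over `F`, then, being symmetric, it has the rank of some vertex-deleted
subgraph (`exists_rk_induce_compl_eq`), hence the rank is at most that of the other graph. So it
suffices to reconstruct `det A` as an integer, which is a theorem of Tutte.

For this, let `D` be the diagonal matrix of degrees. The Laplacian `D - A` is singular, and expanding
its determinant gives `∑ S, det (-A[S]) * ∏ v ∉ S, deg v = 0`
(`sum_negMinor_mul_prod_degree`). The summand for `S = V` is `± det A`, so it is enough that the sum
over the other `S` is reconstructible (`Agree.sum_prod_degree`). The difficulty is that the degrees
are taken in the whole graph. Replace `deg v` by `(1 - x ^ deg v) / (1 - x)`, which tends to it as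
`x → 1`. Expanding the product over `v ∉ S` yields terms `± x ^ (∑ v ∈ Z, deg v)` with `Z` disjoint
from `S`, and with `e` counting edges, `∑ v ∈ Z, deg v = e(V) + e(Z) - e(Zᶜ)`. Hence the sum has the
form `∑ Y, f Y * g Yᶜ` where `f` and `g` are reconstructible invariants of induced subgraphs
(`sum_mul_prod_one_sub_eq`). Such a sum over partitions is reconstructible by an argument of Kocay:
sums over all pairs of subsets of prescribed sizes factor, and Möbius inversion isolates the pairs
that cover `V` (`Agree.sum_mul_compl`).
-/

/-! ### Determinants and ranks of matrices -/

namespace Matrix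

open Finset

variable {n R : Type*} [Fintype n] [DecidableEq n] [CommRing R]

/-- Expansion of `det (D + M)`, with `D` diagonal, in the principal minors of `M`. -/
theorem det_diagonal_add (d : n → R) (M : Matrix n n R) :
    (diagonal d + M).det =
      ∑ S : Finset n, (M.submatrix (Subtype.val : S → n) Subtype.val).det * ∏ i ∈ Sᶜ, d i := by
  let D := (detRowAlternating : (n → R) [⋀^n]→ₗ[R] R)
  have h : (diagonal d + M).det = D ((fun i => M i) + fun i => diagonal d i) := by
    rw [add_comm]; rfl
  rw [h, D.map_add_univ]
  refine sum_congr rfl fun S _ => ?_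
  have hS : S.piecewise (fun i => M i) (fun i => diagonal d i) =
      fun i => (S.piecewise (1 : n → R) d i) •
        S.piecewise (fun i => M i) (fun i => (1 : Matrix n n R) i) i := by
    ext i j
    by_cases hi : i ∈ S
    · simp [hi]
    · simp [hi, diagonal_apply, one_apply]
  rw [hS]
  have h2 := D.toMultilinearMap.map_smul_univ (S.piecewise (1 : n → R) d)
    (S.piecewise (fun i => M i) (fun i => (1 : Matrix n n R) i))
  refine h2.trans ?_
  rw [smul_eq_mul, mul_comm]
  congr 1
  · exact det_piecewise_one_eq_submatrix_det M S
  · rw [prod_piecewise]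
    simp [compl_eq_univ_sdiff]

/-- If `A` is symmetric and has a kernel vector not vanishing at `v`, then row and column `v` are
combinations of the others, so deleting both preserves the rank. -/
theorem IsSymm.rank_submatrix_compl_eq {K : Type*} [Field K] {A : Matrix n n K} (hA : A.IsSymm)
    {x : n → K} (hx : A *ᵥ x = 0) {v : n} (hv : x v ≠ 0) :
    (A.submatrix (Subtype.val : ({v}ᶜ : Finset n) → n)
      (Subtype.val : ({v}ᶜ : Finset n) → n)).rank = A.rank := by
  refine le_antisymm (rank_submatrix_le _ _ _) ?_
  let ι : ({v}ᶜ : Finset n) → n := Subtype.val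
  let B : Matrix ({v}ᶜ : Finset n) n K :=
    of fun w j => if j = v then -(x w / x v) else if (w : n) = j then 1 else 0
  -- column `v` of `A` is a combination of the other columns
  have hB : A = A.submatrix id ι * B := by
    ext i j
    rw [mul_apply]
    have h0 : ∑ w : ({v}ᶜ : Finset n), A i w * B w j = ∑ w ∈ ({v}ᶜ : Finset n),
        A i w * (if j = v then -(x w / x v) else if w = j then 1 else 0) :=
      sum_coe_sort ({v}ᶜ : Finset n) fun w =>
        A i w * (if j = v then -(x w / x v) else if w = j then 1 else 0)
    refine Eq.trans ?_ h0.symm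
    by_cases hj : j = v
    · subst hj
      have h1 : ∑ w, A i w * x w = 0 := congrFun hx i
      rw [← add_sum_erase _ _ (mem_univ j), ← compl_singleton] at h1
      simp only [if_true, mul_neg, sum_neg_distrib, ← mul_div_assoc, ← sum_div]
      field_simp
      linear_combination h1
    · simp [hj]
  have hA' : A = Bᵀ * A.submatrix ι id := by
    conv_lhs => rw [← hA.eq, hB]
    rw [transpose_mul, transpose_submatrix, hA.eq]
  have h3 : A = Bᵀ * A.submatrix ι ι * B := by
    conv_lhs => rw [hA']
    conv_lhs => rw [hB]
    rw [Matrix.mul_assoc]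
    rfl
  conv_lhs => rw [h3]
  exact (rank_mul_le_left _ _).trans (rank_mul_le_right _ _)

end Matrix

namespace SimpleGraph

open Finset Polynomial

/-! ### Kelly's lemma -/

variable {V W : Type u} {R : Type*}

/-- The subgraphs of `G` and `H` induced by the finite vertex sets `S` and `T` are isomorphic. -/
def IndIso (G : SimpleGraph V) (H : SimpleGraph W) (S : Finset V) (T : Finset W) : Prop :=
  Nonempty (G.induce (S : Set V) ≃g H.induce (T : Set W))

namespace IndIso

variable {G : SimpleGraph V} {H : SimpleGraph W} {S : Finset V} {T : Finset W}

theorem exists_equiv (h : IndIso G H S T) :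
    ∃ e : S ≃ T, ∀ a b : S, H.Adj (e a) (e b) ↔ G.Adj a b :=
  h.elim fun e => ⟨e.toEquiv, fun a b => e.map_rel_iff (a := a) (b := b)⟩

theorem of_equiv (e : S ≃ T) (he : ∀ a b : S, H.Adj (e a) (e b) ↔ G.Adj a b) :
    IndIso G H S T :=
  ⟨⟨e, fun {a b} => he a b⟩⟩

theorem card_eq (h : IndIso G H S T) : S.card = T.card :=
  let ⟨e, _⟩ := h.exists_equiv
  Finset.card_eq_of_equiv e

/-- An isomorphism `G[S] ≃ H[T]` carries subsets of `S` to subsets of `T` inducing isomorphic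
subgraphs, so it matches the two sums over subsets term by term. -/
theorem sum_powerset_eq [AddCommMonoid R] (h : IndIso G H S T)
    {f : Finset V → R} {g : Finset W → R}
    (hfg : ∀ A ⊆ S, ∀ B ⊆ T, IndIso G H A B → f A = g B) :
    ∑ A ∈ S.powerset, f A = ∑ B ∈ T.powerset, g B := by
  classical
  obtain ⟨e, he⟩ := h.exists_equiv
  let i : Finset V → Finset W := fun A => T.filter fun w => ∃ h : w ∈ T, (e.symm ⟨w, h⟩ : V) ∈ A
  let j : Finset W → Finset V := fun B => S.filter fun v => ∃ h : v ∈ S, (e ⟨v, h⟩ : W) ∈ B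
  have hi : ∀ A, ∀ a : S, (e a : W) ∈ i A ↔ (a : V) ∈ A := fun A a => by simp [i]
  refine Finset.sum_bij' (fun A _ => i A) (fun B _ => j B) (fun A _ => by simp [i])
    (fun B _ => by simp [j]) ?_ ?_ ?_
  · intro A hA
    rw [mem_powerset] at hA
    ext v
    by_cases hv : v ∈ S
    · simp [i, j, hv]
    · simpa [i, j, hv] using fun h => hv (hA h)
  · intro B hB
    rw [mem_powerset] at hB
    ext v
    by_cases hv : v ∈ T
    · simp [i, j, hv]
    · simpa [i, j, hv] using fun h => hv (hB h)
  · intro A hA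
    rw [mem_powerset] at hA
    refine hfg A hA _ (filter_subset _ _) (of_equiv
      { toFun := fun a => ⟨e ⟨a, hA a.2⟩, (hi A ⟨a, hA a.2⟩).2 a.2⟩
        invFun := fun b => ⟨e.symm ⟨b, (mem_filter.1 b.2).1⟩, by
          obtain ⟨_, h, h'⟩ := mem_filter.1 b.2
          exact h'⟩
        left_inv := fun a => by simp
        right_inv := fun b => by simp } fun a b => ?_)
    exact he _ _

end IndIso

/-- The double count behind Kelly's lemma: `S` lies in the vertex set of exactly `#Sᶜ` of the
vertex-deleted subgraphs. -/
theorem sum_compl_singleton_powerset [Fintype V] [DecidableEq V] [CommSemiring R]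
    (f : Finset V → R) :
    ∑ v, ∑ S ∈ ({v}ᶜ : Finset V).powerset, f S = ∑ S, (#Sᶜ : R) * f S := by
  have : ∀ v, ({v}ᶜ : Finset V).powerset = univ.filter fun S => v ∈ Sᶜ := by
    intro v; ext S; simp
  simp_rw [this, sum_filter]
  rw [sum_comm]
  refine sum_congr rfl fun S _ => ?_
  rw [← sum_filter, filter_mem_eq_inter, univ_inter, sum_const, nsmul_eq_mul]

theorem exists_equiv_of_map_univ_eq {α β : Type*} {γ : Type*} [Fintype α] [Fintype β]
    {f : α → γ} {g : β → γ}
    (h : (univ : Finset α).val.map f = (univ : Finset β).val.map g) :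
    ∃ e : α ≃ β, ∀ a, g (e a) = f a := by
  classical
  have hc : ∀ c, Nonempty ({a // f a = c} ≃ {b // g b = c}) := fun c => by
    rw [← Fintype.card_eq, Fintype.card_subtype, Fintype.card_subtype]
    have := congrArg (Multiset.count c) h
    rw [Multiset.count_map, Multiset.count_map] at this
    simpa [Finset.card, Finset.filter, eq_comm] using this
  exact ⟨Equiv.ofFiberEquiv fun c => (hc c).some, fun a => Equiv.ofFiberEquiv_map _ a⟩

theorem isoType_eq_iff {G : SimpleGraph V} {H : SimpleGraph W} :
    G.isoType = H.isoType ↔ Nonempty (G ≃g H) :=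
  Quotient.eq (r := isoSetoid)

theorem exists_equiv_of_deck_eq [Fintype V] [Fintype W] [DecidableEq V] [DecidableEq W]
    {G : SimpleGraph V} {H : SimpleGraph W} (hdeck : G.deck = H.deck) :
    ∃ σ : V ≃ W, ∀ v, IndIso G H {v}ᶜ {σ v}ᶜ := by
  obtain ⟨σ, hσ⟩ := exists_equiv_of_map_univ_eq hdeck
  refine ⟨σ, fun v => ?_⟩
  rw [IndIso, coe_compl, coe_compl, coe_singleton, coe_singleton]
  exact isoType_eq_iff.1 (hσ v).symm

theorem card_eq_of_deck_eq [Fintype V] [Fintype W] {G : SimpleGraph V} {H : SimpleGraph W}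
    (hdeck : G.deck = H.deck) : Fintype.card V = Fintype.card W := by
  simpa [deck] using congrArg Multiset.card hdeck

/-- **Kelly's lemma**: graphs with the same deck have, for every isomorphism type, equally many
proper induced subgraphs of that type. -/
theorem exists_properSubset_equiv [Fintype V] [Fintype W]
    {G : SimpleGraph V} {H : SimpleGraph W} (hdeck : G.deck = H.deck) :
    ∃ β : {S : Finset V // S ≠ univ} ≃ {T : Finset W // T ≠ univ},
      ∀ S, IndIso G H S.1 (β S).1 := by
  classical
  obtain ⟨σ, hσ⟩ := exists_equiv_of_deck_eq hdeck
  have hVW : Fintype.card V = Fintype.card W := Fintype.card_congr σ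
  suffices h : ∀ τ : IsoType.{u},
      Fintype.card {S : {S : Finset V // S ≠ univ} // (G.induce (S.1 : Set V)).isoType = τ} =
      Fintype.card {T : {T : Finset W // T ≠ univ} // (H.induce (T.1 : Set W)).isoType = τ} by
    refine ⟨Equiv.ofFiberEquiv (f := fun S => (G.induce (S.1 : Set V)).isoType)
      (g := fun T => (H.induce (T.1 : Set W)).isoType)
      fun τ => (Fintype.card_eq.1 (h τ)).some, fun S => ?_⟩
    exact isoType_eq_iff.1 (Equiv.ofFiberEquiv_map (f := fun S : {S : Finset V // S ≠ univ} =>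
      (G.induce (S.1 : Set V)).isoType)
      (g := fun T : {T : Finset W // T ≠ univ} => (H.induce (T.1 : Set W)).isoType) _ S).symm
  intro τ
  -- The weight `1 / (|U| - |S|)` compensates for the number of cards that contain `S`; on `S = U`
  -- the inverse is the junk value `0`, but there the factor `#Sᶜ` vanishes as well.
  have key : ∀ {U : Type u} [Fintype U] [DecidableEq U] (K : SimpleGraph U),
      ((Fintype.card {S : {S : Finset U // S ≠ univ} //
        (K.induce (S.1 : Set U)).isoType = τ} : ℕ) : ℚ) =
      ∑ v, ∑ S ∈ ({v}ᶜ : Finset U).powerset,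
        (if (K.induce (S : Set U)).isoType = τ then ((Fintype.card U - #S : ℚ))⁻¹ else 0) := by
    intro U _ _ K
    rw [sum_compl_singleton_powerset, Fintype.card_congr (Equiv.subtypeSubtypeEquivSubtypeInter
      (fun S : Finset U => S ≠ univ) fun S => (K.induce (S : Set U)).isoType = τ),
      Fintype.card_subtype, card_filter, Nat.cast_sum]
    refine sum_congr rfl fun S _ => ?_
    by_cases hS : S = univ
    · simp [hS]
    · have h1 : (#Sᶜ : ℚ) = Fintype.card U - #S := by
        rw [card_compl, Nat.cast_sub (card_le_univ S)]
      have h2 : (#Sᶜ : ℚ) ≠ 0 := by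
        simpa [Finset.card_eq_zero] using hS
      rw [← h1]
      by_cases h : (K.induce (S : Set U)).isoType = τ <;> simp [h, hS]
  have := key G
  rw [← Nat.cast_inj (R := ℚ), key G, key H]
  refine Fintype.sum_equiv σ _ _ fun v => (hσ v).sum_powerset_eq fun A _ B _ h => ?_
  rw [isoType_eq_iff.2 h, h.card_eq, hVW]

/-! ### Reconstructible set functions -/

/-- The set functions `f` and `g` on the vertex sets of `G` and `H` agree: they take equal values on
proper subsets inducing isomorphic subgraphs, and on the two full vertex sets. The second condition
does not presuppose that `G` and `H` are isomorphic; when `f` and `g` come from one graph invariant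
and the decks are equal, it says that the invariant is reconstructible. -/
structure Agree [Fintype V] [Fintype W] (G : SimpleGraph V) (H : SimpleGraph W)
    (f : Finset V → R) (g : Finset W → R) : Prop where
  proper : ∀ S T, S ≠ univ → T ≠ univ → IndIso G H S T → f S = g T
  whole : f univ = g univ

namespace Agree

variable [Fintype V] [Fintype W] {G : SimpleGraph V} {H : SimpleGraph W}
  {f f' : Finset V → R} {g g' : Finset W → R}

theorem sum_eq [AddCommMonoid R] (hdeck : G.deck = H.deck) (h : Agree G H f g) :
    ∑ S, f S = ∑ T, g T := by
  classical
  obtain ⟨β, hβ⟩ := exists_properSubset_equiv hdeck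
  rw [← add_sum_erase _ _ (mem_univ univ), ← add_sum_erase _ _ (mem_univ univ), h.whole]
  congr 1
  rw [sum_subtype (p := fun S => S ≠ Finset.univ) _ (by simp),
    sum_subtype (p := fun S => S ≠ Finset.univ) _ (by simp)]
  exact Fintype.sum_equiv β _ _ fun S => h.proper _ _ S.2 (β S).2 (hβ S)

theorem mul [Mul R] (h : Agree G H f g) (h' : Agree G H f' g') :
    Agree G H (fun S => f S * f' S) fun T => g T * g' T where
  proper S T hS hT hST := by rw [h.proper S T hS hT hST, h'.proper S T hS hT hST]
  whole := by rw [h.whole, h'.whole]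

theorem sum_powerset [AddCommMonoid R] (hdeck : G.deck = H.deck) (h : Agree G H f g) :
    Agree G H (fun S => ∑ A ∈ S.powerset, f A) fun T => ∑ B ∈ T.powerset, g B where
  proper S T hS hT hST := hST.sum_powerset_eq fun A hA B hB hAB =>
    h.proper A B (fun h => hS (univ_subset_iff.1 (h ▸ hA)))
      (fun h => hT (univ_subset_iff.1 (h ▸ hB))) hAB
  whole := by simpa using h.sum_eq hdeck

end Agree

/-- Möbius inversion turns a sum over ordered partitions `(Y, Yᶜ)` into sums over all pairs `(Y, Z)`
of subsets of `U`, in which `Y` and `Z` vary independently: the alternating sum over `U` keeps the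
pairs with `Y ∪ Z = univ`, and among these the condition `#Y + #Z = |V|` singles out `Z = Yᶜ`. -/
theorem sum_mul_compl_eq [Fintype V] [DecidableEq V] [CommRing R] (f g : Finset V → R) :
    ∑ Y, f Y * g Yᶜ = ∑ a ∈ range (Fintype.card V + 1), ∑ U : Finset V, (-1) ^ #Uᶜ *
      ((∑ Y ∈ U.powerset, if #Y = a then f Y else 0) *
        ∑ Z ∈ U.powerset, if #Z + a = Fintype.card V then g Z else 0) := by
  have alt : ∀ Y Z : Finset V, ∑ U : Finset V, (if Y ⊆ U ∧ Z ⊆ U then (-1 : R) ^ #Uᶜ else 0) =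
      if Y ∪ Z = univ then 1 else 0 := by
    intro Y Z
    have h1 : ∑ U : Finset V, (if Y ⊆ U ∧ Z ⊆ U then (-1 : R) ^ #Uᶜ else 0) =
        ∑ T ∈ (Y ∪ Z)ᶜ.powerset, (-1 : R) ^ #T := by
      rw [← sum_filter]
      refine sum_bij' (fun U _ => Uᶜ) (fun T _ => Tᶜ) ?_ ?_ ?_ ?_ ?_
      · intro U hU
        rw [mem_powerset, compl_subset_compl]
        exact union_subset (mem_filter.1 hU).2.1 (mem_filter.1 hU).2.2
      · intro T hT
        rw [mem_powerset, ← compl_subset_compl, compl_compl] at hT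
        exact mem_filter.2 ⟨mem_univ _, subset_union_left.trans hT, subset_union_right.trans hT⟩
      all_goals simp
    have h2 := congrArg (Int.cast : ℤ → R) (sum_powerset_neg_one_pow_card (x := (Y ∪ Z)ᶜ))
    push_cast at h2
    simp only [h1, h2, compl_eq_empty_iff]
  have expand : ∀ a, ∑ U : Finset V, (-1 : R) ^ #Uᶜ *
      ((∑ Y ∈ U.powerset, if #Y = a then f Y else 0) *
        ∑ Z ∈ U.powerset, if #Z + a = Fintype.card V then g Z else 0) =
      ∑ Y, ∑ Z, (if #Y = a then f Y else 0) * (if #Z + a = Fintype.card V then g Z else 0) *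
        if Y ∪ Z = univ then 1 else 0 := by
    intro a
    simp_rw [← alt, ← filter_subset_univ, sum_filter, sum_mul_sum, mul_sum]
    rw [sum_comm]
    refine sum_congr rfl fun Y _ => ?_
    rw [sum_comm]
    refine sum_congr rfl fun Z _ => sum_congr rfl fun U _ => ?_
    by_cases h1 : Y ⊆ U <;> by_cases h2 : Z ⊆ U <;> simp [h1, h2, mul_comm]
  simp_rw [expand]
  rw [sum_comm]
  refine sum_congr rfl fun Y _ => ?_
  rw [sum_comm, sum_eq_single Yᶜ, sum_eq_single #Y]
  · simp [add_comm, card_add_card_compl]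
  · intro a _ ha
    simp [ha.symm]
  · intro h
    exact absurd (mem_range.2 (Nat.lt_succ_of_le (card_le_univ Y))) h
  · intro Z _ hZ
    refine sum_eq_zero fun a _ => ?_
    by_cases h1 : #Y = a
    · by_cases h2 : #Z + a = Fintype.card V
      · by_cases h3 : Y ∪ Z = univ
        · refine absurd ?_ hZ
          -- a cover of `V` by sets of complementary sizes is a partition
          refine (eq_of_subset_of_card_le (fun v hv => ?_) ?_).symm
          · have := h3.symm ▸ mem_univ v
            exact (mem_union.1 this).resolve_left (mem_compl.1 hv)
          · rw [card_compl]
            omega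
        · simp [h3]
      · simp [h2]
    · simp [h1]
  · simp

/-- **Kocay's lemma** for ordered partitions of the vertex set into two parts. -/
theorem Agree.sum_mul_compl [Fintype V] [Fintype W] [DecidableEq V] [DecidableEq W] [CommRing R]
    {G : SimpleGraph V} {H : SimpleGraph W} {f f' : Finset V → R} {g g' : Finset W → R}
    (hdeck : G.deck = H.deck) (h : Agree G H f g) (h' : Agree G H f' g') :
    ∑ Y, f Y * f' Yᶜ = ∑ Y, g Y * g' Yᶜ := by
  have hVW := card_eq_of_deck_eq hdeck
  rw [sum_mul_compl_eq, sum_mul_compl_eq, hVW]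
  refine sum_congr rfl fun a _ => Agree.sum_eq hdeck (Agree.mul ?_ (Agree.mul ?_ ?_))
  · exact ⟨fun S T _ _ hST => by rw [card_compl, card_compl, hVW, hST.card_eq], by simp⟩
  · refine Agree.sum_powerset hdeck ⟨fun S T hS hT hST => ?_, ?_⟩
    · rw [h.proper S T hS hT hST, hST.card_eq]
    · rw [h.whole, card_univ, card_univ, hVW]
  · refine Agree.sum_powerset hdeck ⟨fun S T hS hT hST => ?_, ?_⟩
    · rw [h'.proper S T hS hT hST, hST.card_eq]
    · rw [h'.whole, card_univ, card_univ, hVW]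

/-! ### Reconstruction of the determinant -/

open Classical in
/-- The number of pairs `(u, v) ∈ S × T` of adjacent vertices. Thus `adjCount S S` is twice the
number of edges inside `S`, and `adjCount {v} univ` is the degree of `v`. -/
noncomputable def adjCount (G : SimpleGraph V) (S T : Finset V) : ℕ :=
  ∑ u ∈ S, ∑ v ∈ T, if G.Adj u v then 1 else 0

theorem adjCount_comm (G : SimpleGraph V) (S T : Finset V) :
    G.adjCount S T = G.adjCount T S := by
  classical
  unfold adjCount
  rw [sum_comm]
  exact sum_congr rfl fun v _ => sum_congr rfl fun u _ => if_congr (G.adj_comm u v) rfl rfl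

theorem IndIso.adjCount_eq {G : SimpleGraph V} {H : SimpleGraph W} {S : Finset V} {T : Finset W}
    (h : IndIso G H S T) : G.adjCount S S = H.adjCount T T := by
  classical
  obtain ⟨e, he⟩ := h.exists_equiv
  simp only [adjCount]
  rw [← sum_coe_sort S, ← sum_coe_sort T]
  refine Fintype.sum_equiv e _ _ fun a => ?_
  rw [← sum_coe_sort S, ← sum_coe_sort T]
  refine Fintype.sum_equiv e _ _ fun b => ?_
  simp only [he]

/-- The degree sum over `Z` is determined by the numbers of edges of `G`, `G[Z]` and `G[Zᶜ]`. -/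
theorem adjCount_compl_add [Fintype V] [DecidableEq V] (G : SimpleGraph V) (Z : Finset V) :
    G.adjCount Zᶜ Zᶜ + 2 * G.adjCount Z univ = G.adjCount univ univ + G.adjCount Z Z := by
  have h : ∀ S : Finset V, G.adjCount S univ = G.adjCount S Z + G.adjCount S Zᶜ := fun S => by
    simp only [adjCount, ← sum_add_distrib, sum_add_sum_compl]
  have h' : G.adjCount univ univ = G.adjCount Z univ + G.adjCount Zᶜ univ :=
    (sum_add_sum_compl Z _).symm
  have := G.adjCount_comm Z Zᶜ
  have := h Z
  have := h Zᶜ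
  omega

/-- The number of edges is reconstructible. This is where at least three vertices are needed. -/
theorem agree_adjCount [Fintype V] [Fintype W] (hV : 3 ≤ Fintype.card V)
    {G : SimpleGraph V} {H : SimpleGraph W} (hdeck : G.deck = H.deck) :
    Agree G H (fun S => G.adjCount S S) fun T => H.adjCount T T := by
  classical
  refine ⟨fun S T _ _ h => h.adjCount_eq, ?_⟩
  obtain ⟨σ, hσ⟩ := exists_equiv_of_deck_eq hdeck
  -- each edge belongs to all but two of the vertex-deleted subgraphs
  have key : ∀ {U : Type u} [Fintype U] [DecidableEq U] (K : SimpleGraph U),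
      ∑ v, K.adjCount {v}ᶜ {v}ᶜ + 2 * K.adjCount univ univ =
        Fintype.card U * K.adjCount univ univ := by
    intro U _ _ K
    have h : ∑ v, K.adjCount {v} univ = K.adjCount univ univ := by simp [adjCount]
    rw [← h, mul_sum, ← sum_add_distrib, h, ← smul_eq_mul, ← card_univ, ← sum_const]
    refine sum_congr rfl fun v _ => ?_
    rw [adjCount_compl_add]
    simp [adjCount]
  have hG := key G
  have hH := key H
  rw [Fintype.sum_equiv σ _ (fun w => H.adjCount {w}ᶜ {w}ᶜ) fun v => (hσ v).adjCount_eq] at hG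
  rw [← Fintype.card_congr σ] at hH
  obtain ⟨m, hm⟩ := Nat.exists_eq_add_of_le hV
  rw [hm] at hG hH
  have : (m + 1) * G.adjCount univ univ = (m + 1) * H.adjCount univ univ := by linarith
  exact Nat.eq_of_mul_eq_mul_left m.succ_pos this

open Classical in
/-- The principal minor indexed by `S` of `-A`, where `A` is the integer adjacency matrix. -/
noncomputable def negMinor (G : SimpleGraph V) (S : Finset V) : ℤ :=
  ((-G.adjMatrix ℤ).submatrix (Subtype.val : S → V) Subtype.val).det

theorem IndIso.negMinor_eq {G : SimpleGraph V} {H : SimpleGraph W} {S : Finset V} {T : Finset W}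
    (h : IndIso G H S T) : G.negMinor S = H.negMinor T := by
  classical
  obtain ⟨e, he⟩ := h.exists_equiv
  rw [negMinor, negMinor, ← Matrix.det_submatrix_equiv_self e]
  congr 1
  ext a b
  simp [he]

/-- The Laplacian `D - A` kills the constant vector; its vanishing determinant, expanded in the
principal minors of `-A`. -/
theorem sum_negMinor_mul_prod_degree [Fintype V] [DecidableEq V] [Nonempty V]
    (G : SimpleGraph V) :
    ∑ S, G.negMinor S * ∏ v ∈ Sᶜ, (G.adjCount {v} univ : ℤ) = 0 := by
  classical
  have h := Matrix.det_diagonal_add (fun v => (G.adjCount {v} univ : ℤ)) (-G.adjMatrix ℤ)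
  refine Eq.trans ?_ (h.symm.trans ?_)
  · refine sum_congr rfl fun S _ => ?_
    rw [negMinor]
    congr!
  · rw [← Matrix.exists_mulVec_eq_zero_iff]
    refine ⟨1, one_ne_zero, ?_⟩
    ext v
    simp [Matrix.mulVec, dotProduct, Matrix.diagonal_apply, adjCount, sum_add_distrib]

/-- With `x = X ^ 2`, expanding `∏ (1 - x ^ deg v)` gives terms `x ^ (degree sum over Z)`, which
split into a factor depending on `Zᶜ` and a factor depending on `Z`. The square avoids halves, as
`adjCount Z Z` counts each edge twice. -/
theorem sum_mul_prod_one_sub_eq [Fintype V] [DecidableEq V]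
    (G : SimpleGraph V) (w : Finset V → ℤ[X]) :
    ∑ S, w S * ∏ v ∈ Sᶜ, (1 - X ^ (2 * G.adjCount {v} univ)) =
      ∑ Y : Finset V, ((∑ S ∈ Y.powerset, w S) * X ^ (G.adjCount univ univ - G.adjCount Y Y)) *
        ((-1) ^ #Yᶜ * X ^ G.adjCount Yᶜ Yᶜ) := by
  have hZ : ∀ Z : Finset V, ∏ v ∈ Z, (X : ℤ[X]) ^ (2 * G.adjCount {v} univ) =
      X ^ (G.adjCount univ univ - G.adjCount Zᶜ Zᶜ) * X ^ G.adjCount Z Z := by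
    intro Z
    rw [prod_pow_eq_pow_sum, ← pow_add, ← mul_sum]
    congr 1
    have h1 : ∑ v ∈ Z, G.adjCount {v} univ = G.adjCount Z univ := by simp [adjCount]
    have h2 := G.adjCount_compl_add Z
    have h3 : G.adjCount Z Z ≤ G.adjCount Z univ := by
      unfold adjCount
      exact sum_le_sum fun u _ => sum_le_sum_of_subset (subset_univ _)
    have h4 : G.adjCount Z univ ≤ G.adjCount univ univ := by
      unfold adjCount
      exact sum_le_sum_of_subset (subset_univ _)
    have h5 : G.adjCount Zᶜ Zᶜ ≤ G.adjCount univ univ := by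
      omega
    omega
  simp_rw [prod_sub, prod_const_one, mul_one, hZ, sum_mul, mul_sum]
  rw [sum_comm' (t' := univ) (s' := fun Z => Zᶜ.powerset)
    (by intro S Z; simp [subset_compl_comm])]
  refine Fintype.sum_equiv (Equiv.mk compl compl compl_compl compl_compl) _ _ fun Z => ?_
  refine sum_congr rfl fun S _ => ?_
  simp only [Equiv.coe_fn_mk, compl_compl]
  ring

theorem Agree.sum_prod_one_sub {G : SimpleGraph V} {H : SimpleGraph W} [Fintype V] [Fintype W]
    [DecidableEq V] [DecidableEq W] (hV : 3 ≤ Fintype.card V) (hdeck : G.deck = H.deck)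
    {f : Finset V → ℤ[X]} {g : Finset W → ℤ[X]} (h : Agree G H f g) :
    ∑ S, f S * ∏ v ∈ Sᶜ, (1 - X ^ (2 * G.adjCount {v} univ)) =
      ∑ T, g T * ∏ v ∈ Tᶜ, (1 - X ^ (2 * H.adjCount {v} univ)) := by
  have hVW := card_eq_of_deck_eq hdeck
  have hE := agree_adjCount hV hdeck
  have hw : G.adjCount univ univ = H.adjCount univ univ := hE.whole
  rw [sum_mul_prod_one_sub_eq, sum_mul_prod_one_sub_eq]
  have h1 : Agree G H (fun S => (X : ℤ[X]) ^ (G.adjCount univ univ - G.adjCount S S))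
      fun T => X ^ (H.adjCount univ univ - H.adjCount T T) :=
    ⟨fun S T hS hT hST => by rw [hw, hST.adjCount_eq], by simp [hw]⟩
  have h2 : Agree G H (fun S => (-1 : ℤ[X]) ^ #S * X ^ G.adjCount S S)
      fun T => (-1) ^ #T * X ^ H.adjCount T T :=
    ⟨fun S T hS hT hST => by rw [hST.adjCount_eq, hST.card_eq],
      by rw [hw, card_univ, card_univ, hVW]⟩
  have key := Agree.sum_mul_compl hdeck ((h.sum_powerset hdeck).mul h1) h2
  exact key

/-- The degree products are the leading coefficients at `x = 1` of the products of
`1 - x ^ deg v`: the weight `(1 - x) ^ #S` makes the order of vanishing the same for all `S`, so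
`(1 - x) ^ |V|` can be cancelled before setting `x = 1`. -/
theorem Agree.sum_prod_degree {G : SimpleGraph V} {H : SimpleGraph W} [Fintype V] [Fintype W]
    [DecidableEq V] [DecidableEq W] (hV : 3 ≤ Fintype.card V) (hdeck : G.deck = H.deck)
    {f : Finset V → ℤ} {g : Finset W → ℤ} (h : Agree G H f g) :
    ∑ S, f S * ∏ v ∈ Sᶜ, (G.adjCount {v} univ : ℤ) =
      ∑ T, g T * ∏ v ∈ Tᶜ, (H.adjCount {v} univ : ℤ) := by
  have hVW := card_eq_of_deck_eq hdeck
  let p : ℤ[X] := 1 - X ^ 2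
  have hp : p ≠ 0 := fun h0 => by simpa [p] using congrArg (eval 0) h0
  have factor : ∀ {U : Type u} [Fintype U] [DecidableEq U] (K : SimpleGraph U)
      (φ : Finset U → ℤ),
      ∑ S, (p ^ #S * C (φ S)) * ∏ v ∈ Sᶜ, (1 - X ^ (2 * K.adjCount {v} univ)) =
        p ^ Fintype.card U * ∑ S, C (φ S) *
          ∏ v ∈ Sᶜ, ∑ i ∈ range (K.adjCount {v} univ), ((X : ℤ[X]) ^ 2) ^ i := by
    intro U _ _ K φ
    rw [mul_sum]
    refine sum_congr rfl fun S _ => ?_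
    have hd : ∀ d, (1 : ℤ[X]) - X ^ (2 * d) = (∑ i ∈ range d, (X ^ 2) ^ i) * p := fun d => by
      rw [pow_mul]
      exact (geom_sum_mul_neg _ _).symm
    simp_rw [hd, prod_mul_distrib, prod_const]
    rw [← card_add_card_compl S, pow_add]
    ring
  have key := Agree.sum_prod_one_sub hV hdeck (f := fun S => p ^ #S * C (f S))
    (g := fun T => p ^ #T * C (g T))
    ⟨fun S T hS hT hST => by rw [h.proper S T hS hT hST, hST.card_eq],
      by rw [h.whole, card_univ, card_univ, hVW]⟩
  rw [factor, factor, ← hVW] at key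
  have := congrArg (eval 1) (mul_left_cancel₀ (pow_ne_zero _ hp) key)
  simpa [eval_finsetSum, eval_prod] using this

/-- The determinant of the adjacency matrix is reconstructible: the vanishing of the Laplacian
determinant expresses it by the terms for proper subsets. -/
theorem negMinor_univ_eq [Fintype V] [Fintype W] {G : SimpleGraph V} {H : SimpleGraph W}
    (hV : 3 ≤ Fintype.card V) (hdeck : G.deck = H.deck) :
    G.negMinor univ = H.negMinor univ := by
  classical
  have hVW := card_eq_of_deck_eq hdeck
  have : Nonempty V := Fintype.card_pos_iff.1 (by omega)
  have : Nonempty W := Fintype.card_pos_iff.1 (by omega)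
  have key := Agree.sum_prod_degree hV hdeck (f := fun S => if S = univ then 0 else G.negMinor S)
    (g := fun T => if T = univ then 0 else H.negMinor T)
    ⟨fun S T hS hT hST => by rw [if_neg hS, if_neg hT, hST.negMinor_eq], by simp⟩
  have split : ∀ {U : Type u} [Fintype U] [DecidableEq U] [Nonempty U] (K : SimpleGraph U),
      K.negMinor univ + ∑ S, (if S = univ then 0 else K.negMinor S) *
        ∏ v ∈ Sᶜ, (K.adjCount {v} univ : ℤ) = 0 := by
    intro U _ _ _ K
    have h1 := sum_erase_add univ
      (fun S => K.negMinor S * ∏ v ∈ Sᶜ, (K.adjCount {v} univ : ℤ)) (mem_univ univ)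
    have h2 := sum_erase_add univ (fun S => (if S = univ then 0 else K.negMinor S) *
      ∏ v ∈ Sᶜ, (K.adjCount {v} univ : ℤ)) (mem_univ univ)
    have h3 : ∀ S ∈ univ.erase (univ : Finset U), (if S = univ then 0 else K.negMinor S) *
        ∏ v ∈ Sᶜ, (K.adjCount {v} univ : ℤ) =
        K.negMinor S * ∏ v ∈ Sᶜ, (K.adjCount {v} univ : ℤ) :=
      fun S hS => by rw [if_neg (ne_of_mem_erase hS)]
    rw [sum_congr rfl h3] at h2
    rw [K.sum_negMinor_mul_prod_degree] at h1
    simp only [compl_univ, prod_empty, mul_one, if_true, add_zero] at h1 h2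
    rw [← h2, add_comm, h1]
  linarith [split G, split H]

/-! ### Reconstruction of the rank and of the interlace polynomial -/

variable (F : Type v) [Field F]

theorem rk_eq_of_iso [Fintype V] [Fintype W] {G : SimpleGraph V} {H : SimpleGraph W}
    (e : G ≃g H) : G.rk F = H.rk F := by
  classical
  rw [rk, rk, ← Matrix.rank_submatrix (H.adjMatrix F) e.toEquiv e.toEquiv]
  congr 1
  ext a b
  simp [adjMatrix_apply, Iso.map_adj_iff]

theorem rk_induce_le [Fintype V] (G : SimpleGraph V) (S : Finset V) :
    (G.induce (S : Set V)).rk F ≤ G.rk F := by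
  classical
  rw [rk, rk]
  refine le_trans (le_of_eq ?_) (Matrix.rank_submatrix_le (G.adjMatrix F)
    (Subtype.val : ↥(S : Set V) → V) (Subtype.val : ↥(S : Set V) → V))
  congr 1

theorem intCast_negMinor_univ [Fintype V] [DecidableEq V] (G : SimpleGraph V)
    [DecidableRel G.Adj] :
    (G.negMinor univ : F) = (-G.adjMatrix F).det := by
  have h : G.negMinor univ = (-G.adjMatrix ℤ).det := by
    rw [negMinor, ← Matrix.det_submatrix_equiv_self (Equiv.subtypeUnivEquiv fun v => mem_univ v)
      (-G.adjMatrix ℤ)]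
    congr!
  rw [h, ← eq_intCast (Int.castRingHom F), RingHom.map_det]
  congr 1
  ext a b
  simp only [RingHom.mapMatrix_apply, Matrix.map_apply, Matrix.neg_apply, adjMatrix_apply]
  split_ifs <;> simp

theorem rk_eq_card [Fintype V] {G : SimpleGraph V} (h : (G.negMinor univ : F) ≠ 0) :
    G.rk F = Fintype.card V := by
  classical
  rw [intCast_negMinor_univ] at h
  rw [Matrix.det_neg] at h
  exact Matrix.rank_of_det_ne_zero (right_ne_zero_of_mul h)

/-- A singular adjacency matrix has the same rank as that of some vertex-deleted subgraph. -/
theorem exists_rk_induce_compl_eq [Fintype V] [DecidableEq V] {G : SimpleGraph V}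
    (h : (G.negMinor univ : F) = 0) :
    ∃ v, (G.induce (({v}ᶜ : Finset V) : Set V)).rk F = G.rk F := by
  classical
  rw [intCast_negMinor_univ] at h
  obtain ⟨x, hx0, hx⟩ := Matrix.exists_mulVec_eq_zero_iff.2 h
  obtain ⟨v, hv⟩ := Function.ne_iff.1 hx0
  refine ⟨v, ?_⟩
  rw [Matrix.neg_mulVec, neg_eq_zero] at hx
  have h1 := Matrix.IsSymm.rank_submatrix_compl_eq (G.isSymm_adjMatrix) hx hv
  rw [rk, rk]
  refine Eq.trans ?_ h1
  congr!

theorem rk_le_of_deck_eq [Fintype V] [Fintype W] {G : SimpleGraph V} {H : SimpleGraph W}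
    (hV : 3 ≤ Fintype.card V) (hdeck : G.deck = H.deck) : G.rk F ≤ H.rk F := by
  classical
  obtain ⟨σ, hσ⟩ := exists_equiv_of_deck_eq hdeck
  by_cases h : (G.negMinor univ : F) = 0
  · obtain ⟨v, hv⟩ := exists_rk_induce_compl_eq F h
    rw [← hv, rk_eq_of_iso F (hσ v).some]
    exact rk_induce_le F H _
  · rw [rk_eq_card F h, rk_eq_card F (negMinor_univ_eq hV hdeck ▸ h), Fintype.card_congr σ]

theorem interlacePolynomial_eq_of_deck_eq [Fintype V] [Fintype W]
    {G : SimpleGraph V} {H : SimpleGraph W} (hV : 3 ≤ Fintype.card V)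
    (hdeck : G.deck = H.deck) : G.interlacePolynomial F = H.interlacePolynomial F := by
  classical
  have hVW := card_eq_of_deck_eq hdeck
  have hrk : G.rk F = H.rk F := le_antisymm (rk_le_of_deck_eq F hV hdeck)
    (rk_le_of_deck_eq F (hVW ▸ hV) hdeck.symm)
  have huniv : ∀ {U : Type u} [Fintype U] (K : SimpleGraph U),
      (K.induce ((univ : Finset U) : Set U)).rk F = K.rk F := fun K =>
    rk_eq_of_iso F (by rw [coe_univ]; exact induceUnivIso K)
  refine Agree.sum_eq hdeck ⟨fun S T _ _ hST => ?_, ?_⟩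
  · rw [nullity, nullity, rk_eq_of_iso F hST.some, Fintype.card_congr hST.some.toEquiv]
  · rw [nullity, nullity, huniv, huniv, hrk]
    simp [hVW]

end SimpleGraph

theorem mainTheorem1 (F : Type v) [Field F] {V W : Type u} [Fintype V] [Fintype W]
    (hV : 3 ≤ Fintype.card V) (G : SimpleGraph V) (H : SimpleGraph W)
    (hdeck : G.deck = H.deck) :
    G.interlacePolynomial F = H.interlacePolynomial F := by
  exact SimpleGraph.interlacePolynomial_eq_of_deck_eq F hV hdeck
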